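/- Let $X$ and $Y$ be Banach spaces over $\mathbb K\in\{\mathbb R,\mathbb C\}$, with $X$ separable and reflexive. Let $\mathcal L\subset B(X,Y)$ be a set of bounded linear operators, equipped with a Hausdorff, $\sigma$-compact, locally compact topology $\tau$ such that for every $x\in X$ the map $L\mapsto Lx$ is continuous from $(\mathcal L,\tau)$ to $Y$. Put $$M=M(X,\mathcal L)=\Big\{x\in X:\ \|x\|_M:=\sup_{L\in\mathcal L}\|Lx\|_Y<\infty\Big\},\qquad M_0=M_0(X,\mathcal L)=\Big\{x\in M:\ \varlimsup_{\mathcal L\ni L\to\infty}\|Lx\|_Y=0\Big\},$$ where $L\to\infty$ means that $L$ escapes all compact subsets of $(\mathcal L,\tau)$. Assume that $M$ is dense in $X$ in the norm of $X$, and that $(M,\|\cdot\|_M)$ is a Banach space continuously contained in $X$; give $M_0$ the norm of $M$. Assume also that for every $x\in M$ there is a sequence $(x_n)_{n\ge1}$ in $M_0$ which converges to $x$ weakly in $X$ and satisfies $\sup_n\|x_n\|_M\le\|x\|_M$. A Banach space $Z$ is called the strongly unique predual of $Z^*$ if every isometric isomorphism from $Z^*$ onto $W^*$, $W$ a Banach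 space, is the adjoint of an isometric isomorphism of $W$ onto $Z$. Suppose that $M_0\ne M$. Then: 1. $M_0^*$ is the strongly unique predual of $M$. That is, there is an isometric isomorphism $I$ of $M_0^{**}$ onto $M$, which is the adjoint $M_0^{**}\to X^{**}=X$ of the restriction map $X^*\to M_0^*$ and acts as the identity on $M_0$; and $M_0^*$ is the strongly unique predual of $M_0^{**}$. 2. $M_0$ is not a strongly unique predual of $M_0^*$. -/

import Mathlib

open Filter Topology

section BigOLittleO

variable {𝕜 X Y : Type*} [RCLike 𝕜] [NormedAddCommGroup X] [NormedSpace 𝕜 X]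
  [NormedAddCommGroup Y] [NormedSpace 𝕜 Y]

/-- The vector space `M(X, 𝓛)` of all `x ∈ X` with `sup_{L ∈ 𝓛} ‖L x‖ < ∞`, as a subspace of `X`. -/
def bigOSubmodule (𝓛 : Set (X →L[𝕜] Y)) : Submodule 𝕜 X where
  carrier := {x | BddAbove (Set.range fun L : 𝓛 => ‖(L : X →L[𝕜] Y) x‖)}
  zero_mem' := ⟨0, by rintro _ ⟨L, rfl⟩; simp⟩
  add_mem' := by
    rintro x y ⟨a, ha⟩ ⟨b, hb⟩
    refine ⟨a + b, ?_⟩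
    rintro _ ⟨L, rfl⟩
    simp only [map_add]
    exact (norm_add_le _ _).trans (add_le_add (ha ⟨L, rfl⟩) (hb ⟨L, rfl⟩))
  smul_mem' := by
    rintro c x ⟨a, ha⟩
    refine ⟨‖c‖ * a, ?_⟩
    rintro _ ⟨L, rfl⟩
    simp only [map_smul, norm_smul]
    exact mul_le_mul_of_nonneg_left (ha ⟨L, rfl⟩) (norm_nonneg c)

/-- The quantity `‖x‖_M = sup_{L ∈ 𝓛} ‖L x‖`. -/
noncomputable def bigONorm (𝓛 : Set (X →L[𝕜] Y)) (x : X) : ℝ :=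
  ⨆ L : 𝓛, ‖(L : X →L[𝕜] Y) x‖

/-- `M(X, 𝓛)` is continuously contained in `X`: the inclusion is bounded from `‖·‖_M` to `‖·‖_X`.
In particular the seminorm `‖·‖_M` is a norm on `M(X, 𝓛)`. -/
class ContinuouslyContained (𝓛 : Set (X →L[𝕜] Y)) : Prop where
  exists_bound : ∃ C : ℝ, ∀ x ∈ bigOSubmodule 𝓛, ‖x‖ ≤ C * bigONorm 𝓛 x

/-- `‖·‖_M` is a norm on `M(X, 𝓛)`. -/
noncomputable def bigOGroupNorm (𝓛 : Set (X →L[𝕜] Y)) [ContinuouslyContained 𝓛] :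
    AddGroupNorm (bigOSubmodule 𝓛) where
  toFun := fun x => bigONorm 𝓛 x
  map_zero' := by simp [bigONorm]
  add_le' := fun x y => by
    refine Real.iSup_le (fun L => ?_) (add_nonneg (Real.iSup_nonneg fun _ => norm_nonneg _)
      (Real.iSup_nonneg fun _ => norm_nonneg _))
    simp only [Submodule.coe_add, map_add]
    exact (norm_add_le _ _).trans (add_le_add (le_ciSup x.2 L) (le_ciSup y.2 L))
  neg' := fun x => by simp [bigONorm]
  eq_zero_of_map_eq_zero' := fun x hx => by
    obtain ⟨C, hC⟩ := ContinuouslyContained.exists_bound (𝓛 := 𝓛)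
    have h := hC x x.2
    rw [show bigONorm 𝓛 (x : X) = 0 from hx, mul_zero] at h
    exact Subtype.ext (by simpa using h)

/-- The space `M(X, 𝓛)`, as a type of its own: it does not carry the norm of `X`, but the norm
`‖x‖_M = sup_{L ∈ 𝓛} ‖L x‖` (see below). -/
def BigO (𝓛 : Set (X →L[𝕜] Y)) : Type _ := bigOSubmodule 𝓛

namespace BigO

variable (𝓛 : Set (X →L[𝕜] Y)) [ContinuouslyContained 𝓛]

/-- `M(X, 𝓛)` with the vector space operations of `X` and the norm `‖·‖_M`. -/
noncomputable instance : NormedAddCommGroup (BigO 𝓛) :=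
  (bigOGroupNorm 𝓛).toNormedAddCommGroup

noncomputable instance : NormedSpace 𝕜 (BigO 𝓛) :=
  { (inferInstanceAs (Module 𝕜 (bigOSubmodule 𝓛)) : Module 𝕜 (bigOSubmodule 𝓛)) with
    norm_smul_le := fun c (x : bigOSubmodule 𝓛) => by
      change bigONorm 𝓛 (c • (x : X)) ≤ ‖c‖ * bigONorm 𝓛 (x : X)
      refine Real.iSup_le (fun L => ?_) (mul_nonneg (norm_nonneg c)
        (Real.iSup_nonneg fun _ => norm_nonneg _))
      simp only [map_smul, norm_smul]
      exact mul_le_mul_of_nonneg_left (le_ciSup x.2 L) (norm_nonneg c) }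

/-- The inclusion of `M(X, 𝓛)` in `X`, a bounded linear map. -/
noncomputable def toX : BigO 𝓛 →L[𝕜] X :=
  LinearMap.mkContinuousOfExistsBound
    { toFun := fun x : bigOSubmodule 𝓛 => (x : X)
      map_add' := fun _ _ => rfl
      map_smul' := fun _ _ => rfl }
    (ContinuouslyContained.exists_bound.imp fun _ hC x => hC _ x.2)

variable {𝓛}

theorem norm_def (x : BigO 𝓛) : ‖x‖ = ⨆ L : 𝓛, ‖(L : X →L[𝕜] Y) (toX 𝓛 x)‖ := rfl

theorem toX_injective : Function.Injective (toX 𝓛) := Subtype.val_injective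

theorem range_toX : Set.range (toX 𝓛) = bigOSubmodule 𝓛 := Subtype.range_val

theorem le_norm (x : BigO 𝓛) (L : 𝓛) : ‖(L : X →L[𝕜] Y) (toX 𝓛 x)‖ ≤ ‖x‖ :=
  le_ciSup (f := fun L : 𝓛 => ‖(L : X →L[𝕜] Y) (toX 𝓛 x)‖) x.2 L

end BigO

variable (𝓛 : Set (X →L[𝕜] Y)) [ContinuouslyContained 𝓛] (τ : TopologicalSpace 𝓛)

/-- The space `M₀(X, 𝓛)` of all `x ∈ M(X, 𝓛)` such that `‖L x‖ → 0` as `L` escapes all compact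
sets of `(𝓛, τ)`; a subspace of `M(X, 𝓛)`, whose norm it inherits. The topology `τ` on `𝓛` is a
free datum, not the one induced by the operator norm. -/
def LittleO : Submodule 𝕜 (BigO 𝓛) where
  carrier := {x | Tendsto (fun L : 𝓛 => ‖(L : X →L[𝕜] Y) (BigO.toX 𝓛 x)‖)
    (@Filter.cocompact 𝓛 τ) (𝓝 0)}
  zero_mem' := by simp [tendsto_const_nhds]
  add_mem' := by
    intro x y hx hy
    refine squeeze_zero (fun _ => norm_nonneg _) (fun L => ?_) (by simpa using Tendsto.add hx hy)
    simp only [map_add]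
    exact norm_add_le _ _
  smul_mem' := by
    intro c x hx
    have h := Tendsto.const_mul ‖c‖ hx
    simpa [norm_smul] using h

theorem LittleO.isClosed : IsClosed (LittleO 𝓛 τ : Set (BigO 𝓛)) := by
  refine isClosed_of_closure_subset fun x hx => ?_
  refine (Metric.tendsto_nhds (a := (0 : ℝ))).2 fun ε hε => ?_
  obtain ⟨y, hy, hxy⟩ := Metric.mem_closure_iff.1 hx (ε / 2) (half_pos hε)
  have h2 := (Metric.tendsto_nhds (a := (0 : ℝ))).1 hy (ε / 2) (half_pos hε)
  filter_upwards [h2] with L hL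
  rw [dist_zero_right, norm_norm] at hL ⊢
  rw [dist_eq_norm] at hxy
  have h3 := BigO.le_norm (x - y) L
  have h4 : ‖(L : X →L[𝕜] Y) (BigO.toX 𝓛 x)‖ ≤
      ‖(L : X →L[𝕜] Y) (BigO.toX 𝓛 (x - y))‖ + ‖(L : X →L[𝕜] Y) (BigO.toX 𝓛 y)‖ := by
    simpa using norm_add_le ((L : X →L[𝕜] Y) (BigO.toX 𝓛 (x - y)))
      ((L : X →L[𝕜] Y) (BigO.toX 𝓛 y))
  linarith

instance [CompleteSpace (BigO 𝓛)] : CompleteSpace (LittleO 𝓛 τ) :=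
  (LittleO.isClosed 𝓛 τ).completeSpace_coe

/-- The approximation property: every `x ∈ M` is the weak limit in `X` of a sequence in `M₀`
whose norms in `M` do not exceed that of `x`. -/
def ApproximationProperty : Prop :=
  ∀ x : BigO 𝓛, ∃ u : ℕ → BigO 𝓛, (∀ n, u n ∈ LittleO 𝓛 τ) ∧ (∀ n, ‖u n‖ ≤ ‖x‖) ∧
    ∀ ℓ : StrongDual 𝕜 X,
      Tendsto (fun n => ℓ (BigO.toX 𝓛 (u n))) atTop (𝓝 (ℓ (BigO.toX 𝓛 x)))

end BigOLittleO

universe u v w k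

/-- The Banach space `Z` is the strongly unique predual of its dual `Z*`: every isometric
isomorphism from `Z*` onto `W*`, `W` a Banach space (in the universe `w`), is the adjoint of an
isometric isomorphism of `W` onto `Z`. -/
def IsStronglyUniquePredual (𝕜 : Type k) [RCLike 𝕜] (Z : Type u) [NormedAddCommGroup Z]
    [NormedSpace 𝕜 Z] [CompleteSpace Z] : Prop :=
  ∀ (W : Type w) [NormedAddCommGroup W] [NormedSpace 𝕜 W] [CompleteSpace W]
    (Φ : StrongDual 𝕜 Z ≃ₗᵢ[𝕜] StrongDual 𝕜 W),
    ∃ φ : W ≃ₗᵢ[𝕜] Z, ∀ (f : StrongDual 𝕜 Z) (y : W), Φ f y = f (φ y)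

/-! ### Consequences of the Hahn–Banach theorem. -/

section HahnBanach

variable {𝕜 : Type*} [RCLike 𝕜]

/-! An element of `M₀` is, up to ε, carried by a compact `K ⊆ 𝓛`, on which Banach–Steinhaus bounds
the operators uniformly. A bounded sequence of `M` that is null in `X` is therefore eventually small
on `K`, so the norm of its sum with the given element barely exceeds the larger of the two bounds
(`LittleO.eventually_norm_add_le`). Splitting `𝓛` into `K` and its complement also shows that `X*`
is dense in `M₀*`, so `M₀**` embeds in `X** = X`; the approximation property identifies the image
with `M`.

For any predual of `M`, a weak* cluster point `y` of a sequence bounded by `C` in `M` and null in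
`X` satisfies `‖x + y‖ ≤ max ‖x‖ C` for every `x ∈ M`. Taking for `x` a multiple of `y` forces `y =
0` (`BigO.tendsto_predual`). Hence, whatever the predual, an element of `M` is the weak* limit of
its approximants from `M₀`, and an isometry `M₀** ≃ W*` is the adjoint of the map that its values on
`M₀` determine.

For the negative part, tilt `M₀` inside `M` to `W = {z + f(z) G : z ∈ M₀}`, with `G ∉ M₀` and `f ≠
0` small. Restriction to `W` still identifies `M₀*` isometrically with `W*`, yet `W` is not
contained in `M₀`, so this identification is not an adjoint. -/

theorem exists_strongDual_comp_eq {V B : Type*} [AddCommGroup V] [Module 𝕜 V]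
    [NormedAddCommGroup B] [NormedSpace 𝕜 B] (j : V →ₗ[𝕜] B) (hj : Function.Injective j)
    (f : V →ₗ[𝕜] 𝕜) {C : ℝ} (hC : 0 ≤ C) (hf : ∀ v, ‖f v‖ ≤ C * ‖j v‖) :
    ∃ g : StrongDual 𝕜 B, (∀ v, g (j v) = f v) ∧ ‖g‖ ≤ C := by
  let e := LinearEquiv.ofInjective j hj
  have he : ∀ v, (e v : B) = j v := fun v => rfl
  let f₀ : StrongDual 𝕜 (LinearMap.range j) :=
    LinearMap.mkContinuous (f ∘ₗ (e.symm : LinearMap.range j →ₗ[𝕜] V)) C fun y => by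
      obtain ⟨v, rfl⟩ := e.surjective y
      simpa [he] using hf v
  obtain ⟨g, hg, hgn⟩ := exists_extension_norm_eq (LinearMap.range j) f₀
  refine ⟨g, fun v => ?_, hgn.le.trans (LinearMap.mkContinuous_norm_le _ hC _)⟩
  have := hg (e v)
  simpa [f₀, he] using this

theorem exists_strongDual_vanishing {E : Type*} [NormedAddCommGroup E] [NormedSpace 𝕜 E]
    (p : Submodule 𝕜 E) (hp : IsClosed (p : Set E)) {x : E} (hx : x ∉ p) :
    ∃ f : StrongDual 𝕜 E, (∀ y ∈ p, f y = 0) ∧ f x ≠ 0 := by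
  have : IsClosed (p : Set E) := hp
  have hne : p.mkQL x ≠ 0 := by simpa using hx
  obtain ⟨g, hg⟩ := SeparatingDual.exists_ne_zero (R := 𝕜) hne
  refine ⟨g.comp p.mkQL, fun y hy => ?_, hg⟩
  have : p.mkQL y = 0 := by simpa using hy
  simp [this]

/-- The dual of a sup-norm product is an ℓ¹-sum: rotating both components by unimodular scalars
makes the two values add up. -/
theorem StrongDual.norm_inl_add_norm_inr_le {E F : Type*} [NormedAddCommGroup E] [NormedSpace 𝕜 E]
    [NormedAddCommGroup F] [NormedSpace 𝕜 F] (g : StrongDual 𝕜 (E × F)) (u : E) (v : F) :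
    ‖g (u, 0)‖ + ‖g (0, v)‖ ≤ ‖g‖ * max ‖u‖ ‖v‖ := by
  obtain ⟨c, hc, hcu⟩ := RCLike.exists_norm_eq_mul_self (g (u, 0))
  obtain ⟨d, hd, hdv⟩ := RCLike.exists_norm_eq_mul_self (g (0, v))
  have h : g (c • u, d • v) = ((‖g (u, 0)‖ + ‖g (0, v)‖ : ℝ) : 𝕜) := by
    have : ((c • u, d • v) : E × F) = c • (u, 0) + d • (0, v) := by simp
    rw [this, map_add, map_smul, map_smul, smul_eq_mul, smul_eq_mul, ← hcu, ← hdv]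
    push_cast; rfl
  have h2 := g.le_opNorm (c • u, d • v)
  rw [h, RCLike.norm_of_nonneg (by positivity), Prod.norm_def] at h2
  simpa [norm_smul, hc, hd] using h2

/-- Mazur's lemma: a point off the closed convex hull is strictly separated from it by a functional,
against weak convergence. -/
theorem mem_closure_of_forall_tendsto {E : Type*} [NormedAddCommGroup E] [NormedSpace 𝕜 E]
    [Module ℝ E] [IsScalarTower ℝ 𝕜 E] {s : Set E} (hs : Convex ℝ s) {u : ℕ → E} {x : E}
    (hu : ∀ n, u n ∈ s)
    (hx : ∀ ℓ : StrongDual 𝕜 E, Tendsto (fun n => ℓ (u n)) atTop (𝓝 (ℓ x))) :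
    x ∈ closure s := by
  let _ : NormedSpace ℝ E :=
    { (inferInstance : Module ℝ E) with
      norm_smul_le := fun r x => by
        rw [← one_smul 𝕜 x, ← smul_assoc, norm_smul, one_smul]
        simp [norm_smul] }
  by_contra hxs
  obtain ⟨f, r, hfs, hfx⟩ := RCLike.geometric_hahn_banach_closed_point (𝕜 := 𝕜)
    hs.closure isClosed_closure hxs
  have h := (RCLike.continuous_re.tendsto (f x)).comp (hx f)
  exact hfx.not_ge (le_of_tendsto h (Eventually.of_forall fun n =>
    (hfs _ (subset_closure (hu n))).le))

end HahnBanach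

/-! ### Splitting `𝓛` into a compact set and its complement. -/

section LittleOEmbedding

variable {𝕜 X Y : Type*} [RCLike 𝕜] [NormedAddCommGroup X] [NormedSpace 𝕜 X]
  [NormedAddCommGroup Y] [NormedSpace 𝕜 Y] {𝓛 : Set (X →L[𝕜] Y)} [ContinuouslyContained 𝓛]

theorem BigO.norm_le {x : BigO 𝓛} {a : ℝ} (ha : 0 ≤ a)
    (h : ∀ L : 𝓛, ‖(L : X →L[𝕜] Y) (BigO.toX 𝓛 x)‖ ≤ a) : ‖x‖ ≤ a :=
  Real.iSup_le h ha

variable (𝓛) in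
/-- The embedding of `M(X, 𝓛)` in `ℓ^∞(𝓛, Y)`, followed by restriction to `A ⊆ 𝓛`. -/
noncomputable def BigO.evalOn (A : Set 𝓛) : BigO 𝓛 →ₗ[𝕜] lp (fun _ : A => Y) ⊤ where
  toFun x := ⟨fun L => ((L : 𝓛) : X →L[𝕜] Y) (BigO.toX 𝓛 x),
    memℓp_infty ⟨‖x‖, by rintro _ ⟨L, rfl⟩; exact BigO.le_norm x L⟩⟩
  map_add' x y := by ext L; simp; rfl
  map_smul' c x := by ext L; simp

theorem BigO.norm_evalOn_le (A : Set 𝓛) {x : BigO 𝓛} {a : ℝ} (ha : 0 ≤ a)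
    (h : ∀ L ∈ A, ‖(L : X →L[𝕜] Y) (BigO.toX 𝓛 x)‖ ≤ a) : ‖BigO.evalOn 𝓛 A x‖ ≤ a :=
  lp.norm_le_of_forall_le ha fun L => h L L.2

theorem BigO.norm_le_max_evalOn (A : Set 𝓛) (x : BigO 𝓛) :
    ‖x‖ ≤ max ‖BigO.evalOn 𝓛 A x‖ ‖BigO.evalOn 𝓛 Aᶜ x‖ := by
  refine BigO.norm_le (le_max_of_le_left (norm_nonneg _)) fun L => ?_
  by_cases hL : L ∈ A
  · exact le_max_of_le_left
      (lp.norm_apply_le_norm ENNReal.top_ne_zero (BigO.evalOn 𝓛 A x) ⟨L, hL⟩)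
  · exact le_max_of_le_right
      (lp.norm_apply_le_norm ENNReal.top_ne_zero (BigO.evalOn 𝓛 Aᶜ x) ⟨L, hL⟩)

variable (τ : TopologicalSpace 𝓛)

/-- Strong continuity bounds each orbit over a compact set, so Banach–Steinhaus applies. From here
on `τ` matters only through such sets `K`. -/
theorem LittleO.exists_bounded_set [CompleteSpace X]
    (hcont : ∀ x : X, @Continuous 𝓛 Y τ _ fun L => (L : X →L[𝕜] Y) x)
    {x : BigO 𝓛} (hx : x ∈ LittleO 𝓛 τ) {ε : ℝ} (hε : 0 < ε) :
    ∃ (K : Set 𝓛) (B : ℝ), 0 ≤ B ∧ (∀ L ∈ K, ‖(L : X →L[𝕜] Y)‖ ≤ B) ∧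
      ∀ L ∉ K, ‖(L : X →L[𝕜] Y) (BigO.toX 𝓛 x)‖ ≤ ε := by
  have hx' : ∀ᶠ L : 𝓛 in @Filter.cocompact 𝓛 τ, ‖(L : X →L[𝕜] Y) (BigO.toX 𝓛 x)‖ < ε :=
    Tendsto.eventually_lt_const hε hx
  obtain ⟨K, hK, hKε⟩ := (@Filter.mem_cocompact 𝓛 τ _).1 hx'
  obtain ⟨B, hB⟩ := banach_steinhaus (g := fun L : K => ((L : 𝓛) : X →L[𝕜] Y)) fun x => by
    obtain ⟨C, hC⟩ := @IsCompact.exists_bound_of_continuousOn 𝓛 Y _ τ K hK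
      (fun L => (L : X →L[𝕜] Y) x) (@Continuous.continuousOn 𝓛 Y τ _ _ _ (hcont x))
    exact ⟨C, fun L => hC L L.2⟩
  refine ⟨K, max B 0, le_max_right _ _, fun L hL => le_max_of_le_left (hB ⟨L, hL⟩),
    fun L hL => ?_⟩
  exact le_of_lt (hKε hL)

/-- On `K` the term `v i` is negligible, off `K` the term `x` is. -/
theorem LittleO.eventually_norm_add_le [CompleteSpace X]
    (hcont : ∀ x : X, @Continuous 𝓛 Y τ _ fun L => (L : X →L[𝕜] Y) x)
    {x : BigO 𝓛} (hx : x ∈ LittleO 𝓛 τ) {ι : Type*} {l : Filter ι} {v : ι → BigO 𝓛} {C : ℝ}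
    (hC : ∀ i, ‖v i‖ ≤ C) (hv : Tendsto (fun i => BigO.toX 𝓛 (v i)) l (𝓝 0))
    {ε : ℝ} (hε : 0 < ε) : ∀ᶠ i in l, ‖x + v i‖ ≤ max ‖x‖ C + ε := by
  obtain ⟨K, B, hB, hK, hKε⟩ := LittleO.exists_bounded_set τ hcont hx hε
  have h : Tendsto (fun i => B * ‖BigO.toX 𝓛 (v i)‖) l (𝓝 0) := by
    simpa using hv.norm.const_mul B
  filter_upwards [h.eventually_lt_const hε] with i hi
  refine BigO.norm_le (add_nonneg (le_max_of_le_left (norm_nonneg _)) hε.le) fun L => ?_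
  rw [map_add, map_add]
  refine (norm_add_le _ _).trans ?_
  by_cases hL : L ∈ K
  · exact add_le_add ((BigO.le_norm x L).trans (le_max_left _ _))
      ((((L : X →L[𝕜] Y).le_opNorm _).trans
        (mul_le_mul_of_nonneg_right (hK L hL) (norm_nonneg _))).trans hi.le)
  · rw [add_comm]
    exact add_le_add (((BigO.le_norm _ L).trans (hC i)).trans (le_max_right _ _)) (hKε L hL)

/-- The restrictions to `M₀` of the functionals in `X*` are norm dense in `M₀*`. -/
theorem LittleO.exists_norm_sub_le [CompleteSpace X]
    (hcont : ∀ x : X, @Continuous 𝓛 Y τ _ fun L => (L : X →L[𝕜] Y) x)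
    (f : StrongDual 𝕜 (LittleO 𝓛 τ)) {ε : ℝ} (hε : 0 < ε) :
    ∃ ℓ : StrongDual 𝕜 X,
      ‖f - (ℓ.comp (BigO.toX 𝓛)).comp (LittleO 𝓛 τ).subtypeL‖ ≤ ε := by
  -- Since `x` almost norms `f` and is small off `K`, the `K`-component of an extension of `f` uses
  -- up almost all of its norm, leaving at most ε for the other.
  obtain ⟨x, hx1, hxf⟩ := f.exists_lt_apply_of_lt_opNorm (sub_lt_self ‖f‖ (half_pos hε))
  have hf0 : 0 < ‖f‖ + 1 := by positivity
  obtain ⟨K, B, hB, hK, hKx⟩ := LittleO.exists_bounded_set τ hcont x.2 (div_pos (half_pos hε) hf0)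
  let j : LittleO 𝓛 τ →ₗ[𝕜] lp (fun _ : K => Y) ⊤ × lp (fun _ : (Kᶜ : Set 𝓛) => Y) ⊤ :=
    ((BigO.evalOn 𝓛 K).prod (BigO.evalOn 𝓛 Kᶜ)) ∘ₗ (LittleO 𝓛 τ).subtype
  have hj : ∀ y, ‖y‖ ≤ ‖j y‖ := fun y => BigO.norm_le_max_evalOn K (y : BigO 𝓛)
  obtain ⟨g, hgf, hg⟩ := exists_strongDual_comp_eq j
    ((injective_iff_map_eq_zero j).2 fun y hy => by simpa [hy] using hj y) f.toLinearMap
    (norm_nonneg f)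
    fun y => (f.le_opNorm y).trans (mul_le_mul_of_nonneg_left (hj y) (norm_nonneg f))
  have hsum : ∀ y : LittleO 𝓛 τ, f y = g (BigO.evalOn 𝓛 K y, 0) + g (0, BigO.evalOn 𝓛 Kᶜ y) :=
    fun y => by
      rw [← map_add]
      simpa [j] using (hgf y).symm
  -- The `K`-component is bounded for the norm of `X`, hence comes from `X*`.
  obtain ⟨ℓ, hℓ, -⟩ := exists_strongDual_comp_eq (BigO.toX 𝓛).toLinearMap BigO.toX_injective
    (g.toLinearMap ∘ₗ LinearMap.inl 𝕜 _ _ ∘ₗ BigO.evalOn 𝓛 K) (C := ‖f‖ * B) (by positivity)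
    fun y => by
      have h1 : ‖BigO.evalOn 𝓛 K y‖ ≤ B * ‖BigO.toX 𝓛 y‖ :=
        BigO.norm_evalOn_le K (by positivity) fun L hL =>
          ((L : X →L[𝕜] Y).le_opNorm _).trans
            (mul_le_mul_of_nonneg_right (hK L hL) (norm_nonneg _))
      have h2 := g.le_of_opNorm_le_of_le hg
        (x := ((BigO.evalOn 𝓛 K y, 0) : _ × lp (fun _ : (Kᶜ : Set 𝓛) => Y) ⊤))
        (b := B * ‖BigO.toX 𝓛 y‖) (by simpa [Prod.norm_def] using h1)
      simpa [mul_assoc] using h2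
  refine ⟨ℓ, ContinuousLinearMap.opNorm_le_bound _ hε.le fun y => ?_⟩
  have hfy : (f - (ℓ.comp (BigO.toX 𝓛)).comp (LittleO 𝓛 τ).subtypeL) y =
      g (0, BigO.evalOn 𝓛 Kᶜ y) := by
    have := hℓ y
    simp only [ContinuousLinearMap.coe_coe, LinearMap.coe_comp, Function.comp_apply,
      LinearMap.inl_apply] at this
    simp [this, hsum y]
  rw [hfy]
  have hbx : ‖g (0, BigO.evalOn 𝓛 Kᶜ x)‖ ≤ ε / 2 := by
    have h1 := g.le_of_opNorm_le_of_le hg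
      (x := ((0, BigO.evalOn 𝓛 Kᶜ x) : lp (fun _ : K => Y) ⊤ × _))
      (b := ε / 2 / (‖f‖ + 1))
      (by
        have := BigO.norm_evalOn_le Kᶜ (by positivity) hKx
        simpa [Prod.norm_def] using this)
    refine h1.trans ?_
    rw [mul_div_assoc', div_le_iff₀ hf0]
    nlinarith
  have hax : ‖f‖ - ε ≤ ‖g (BigO.evalOn 𝓛 K x, 0)‖ := by
    have := norm_add_le (g (BigO.evalOn 𝓛 K x, 0)) (g (0, BigO.evalOn 𝓛 Kᶜ x))
    rw [← hsum] at this
    linarith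
  -- Scaling `x` by `‖y‖` gives both components norm at most `‖y‖`.
  have h := g.norm_inl_add_norm_inr_le ((‖y‖ : 𝕜) • BigO.evalOn 𝓛 K x) (BigO.evalOn 𝓛 Kᶜ y)
  have hKx1 : ‖BigO.evalOn 𝓛 K x‖ ≤ 1 :=
    BigO.norm_evalOn_le K zero_le_one fun L _ => (BigO.le_norm _ L).trans hx1.le
  have hKy : ‖BigO.evalOn 𝓛 Kᶜ y‖ ≤ ‖y‖ :=
    BigO.norm_evalOn_le Kᶜ (norm_nonneg _) fun L _ => BigO.le_norm _ L
  have hmax : max ‖(‖y‖ : 𝕜) • BigO.evalOn 𝓛 K x‖ ‖BigO.evalOn 𝓛 Kᶜ y‖ ≤ ‖y‖ := by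
    refine max_le ?_ hKy
    rw [norm_smul, RCLike.norm_ofReal, abs_norm]
    exact mul_le_of_le_one_right (norm_nonneg _) hKx1
  have hsm : g ((‖y‖ : 𝕜) • BigO.evalOn 𝓛 K x, 0) = (‖y‖ : 𝕜) * g (BigO.evalOn 𝓛 K x, 0) := by
    rw [← smul_eq_mul, ← map_smul g, Prod.smul_mk, smul_zero]
  rw [hsm, norm_mul, RCLike.norm_ofReal, abs_norm] at h
  have h3 : ‖g‖ * max ‖(‖y‖ : 𝕜) • BigO.evalOn 𝓛 K x‖ ‖BigO.evalOn 𝓛 Kᶜ y‖ ≤ ‖f‖ * ‖y‖ :=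
    mul_le_mul hg hmax (le_max_of_le_right (norm_nonneg _)) (norm_nonneg _)
  nlinarith [mul_le_mul_of_nonneg_left hax (norm_nonneg y)]

end LittleOEmbedding

/-- Banach–Alaoglu; ultrafilters replace subsequences, so `E` need not be separable. -/
theorem StrongDual.exists_ultrafilter_limit {𝕜 E ι : Type*} [RCLike 𝕜] [NormedAddCommGroup E]
    [NormedSpace 𝕜 E] (U : Ultrafilter ι) {g : ι → StrongDual 𝕜 E} {C : ℝ} (hg : ∀ i, ‖g i‖ ≤ C) :
    ∃ h : StrongDual 𝕜 E, ‖h‖ ≤ C ∧ ∀ x, Tendsto (fun i => g i x) U (𝓝 (h x)) := by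
  obtain ⟨h, hh, hU⟩ := 
    (WeakDual.isCompact_closedBall (𝕜 := 𝕜) (0 : StrongDual 𝕜 E) C).ultrafilter_le_nhds (U.map fun i => StrongDual.toWeakDual (g i)) (by
      refine le_principal_iff.2 (Filter.mem_map.2 (Filter.univ_mem' fun i => ?_))
      simpa using hg i)
  refine ⟨WeakDual.toStrongDual h, by simpa using hh, fun x => ?_⟩
  exact ((WeakDual.eval_continuous x).tendsto h).comp hU

/-! ### The bidual of `M₀` and weak* null sequences. -/

section LittleODuality

variable {𝕜 X Y : Type*} [RCLike 𝕜] [NormedAddCommGroup X] [NormedSpace 𝕜 X]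
  [NormedAddCommGroup Y] [NormedSpace 𝕜 Y] {𝓛 : Set (X →L[𝕜] Y)} [ContinuouslyContained 𝓛]
  {τ : TopologicalSpace 𝓛}

/-- By Mazur's lemma, the approximation property improves from weak to norm convergence in `X`. -/
theorem ApproximationProperty.exists_tendsto (h : ApproximationProperty 𝓛 τ) (x : BigO 𝓛) :
    ∃ u : ℕ → BigO 𝓛, (∀ n, u n ∈ LittleO 𝓛 τ) ∧ (∀ n, ‖u n‖ ≤ ‖x‖) ∧
      Tendsto (fun n => BigO.toX 𝓛 (u n)) atTop (𝓝 (BigO.toX 𝓛 x)) := by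
  let _ : NormedSpace ℝ X := NormedSpace.restrictScalars ℝ 𝕜 X
  obtain ⟨u, hu0, hux, hu⟩ := h x
  let s : Set X := {y | ∃ u ∈ LittleO 𝓛 τ, ‖u‖ ≤ ‖x‖ ∧ BigO.toX 𝓛 u = y}
  have hs : Convex ℝ s := by
    rintro _ ⟨v, hv, hvx, rfl⟩ _ ⟨w, hw, hwx, rfl⟩ a b ha hb hab
    refine ⟨(a : 𝕜) • v + (b : 𝕜) • w,
      add_mem (Submodule.smul_mem _ _ hv) (Submodule.smul_mem _ _ hw), ?_, ?_⟩
    · refine (norm_add_le _ _).trans ?_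
      rw [norm_smul, norm_smul, RCLike.norm_of_nonneg ha, RCLike.norm_of_nonneg hb]
      calc a * ‖v‖ + b * ‖w‖ ≤ a * ‖x‖ + b * ‖x‖ := by gcongr
        _ = ‖x‖ := by rw [← add_mul, hab, one_mul]
    · rw [map_add, map_smul, map_smul]
      rfl
  have hx : BigO.toX 𝓛 x ∈ closure s :=
    mem_closure_of_forall_tendsto (𝕜 := 𝕜) hs (fun n => ⟨u n, hu0 n, hux n, rfl⟩) hu
  obtain ⟨y, hy, hyx⟩ := mem_closure_iff_seq_limit.1 hx
  choose v hv0 hvx hvy using hy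
  exact ⟨v, hv0, hvx, by simpa only [hvy] using hyx⟩

/-- The adjoint `M₀** → X** = X` of the restriction `X* → M₀*` is an isometry onto `M`. -/
theorem LittleO.exists_bidual_equiv [CompleteSpace X]
    (hX : Function.Surjective (NormedSpace.inclusionInDoubleDual 𝕜 X))
    (hcont : ∀ x : X, @Continuous 𝓛 Y τ _ fun L => (L : X →L[𝕜] Y) x)
    (happrox : ApproximationProperty 𝓛 τ) :
    ∃ I : StrongDual 𝕜 (StrongDual 𝕜 (LittleO 𝓛 τ)) ≃ₗᵢ[𝕜] BigO 𝓛,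
      (∀ (F : StrongDual 𝕜 (StrongDual 𝕜 (LittleO 𝓛 τ))) (ℓ : StrongDual 𝕜 X),
        ℓ (BigO.toX 𝓛 (I F)) = F ((ℓ.comp (BigO.toX 𝓛)).comp (LittleO 𝓛 τ).subtypeL)) ∧
      (∀ x : LittleO 𝓛 τ, I (NormedSpace.inclusionInDoubleDual 𝕜 (LittleO 𝓛 τ) x) = x) := by
  let r : StrongDual 𝕜 X →L[𝕜] StrongDual 𝕜 (LittleO 𝓛 τ) :=
    (ContinuousLinearMap.compL 𝕜 (LittleO 𝓛 τ) X 𝕜).flip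
      ((BigO.toX 𝓛).comp (LittleO 𝓛 τ).subtypeL)
  have hr : ∀ ℓ, r ℓ = (ℓ.comp (BigO.toX 𝓛)).comp (LittleO 𝓛 τ).subtypeL := fun ℓ => rfl
  choose P hP using fun F : StrongDual 𝕜 (StrongDual 𝕜 (LittleO 𝓛 τ)) => hX (F.comp r)
  have hPF : ∀ F (ℓ : StrongDual 𝕜 X), ℓ (P F) = F (r ℓ) := fun F ℓ => by
    simpa using DFunLike.congr_fun (hP F) ℓ
  have hPL : ∀ F (L : 𝓛), ‖(L : X →L[𝕜] Y) (P F)‖ ≤ ‖F‖ := fun F L => by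
    -- Composed with `L`, a norming functional on `Y` restricts to the unit ball of `M₀*`.
    obtain ⟨g, hg, hgL⟩ := exists_dual_vector'' 𝕜 ((L : X →L[𝕜] Y) (P F))
    have h1 : ‖r (g.comp (L : X →L[𝕜] Y))‖ ≤ 1 :=
      ContinuousLinearMap.opNorm_le_bound _ zero_le_one fun z => by
        refine (g.le_of_opNorm_le hg _).trans ?_
        exact mul_le_mul_of_nonneg_left (BigO.le_norm (z : BigO 𝓛) L) zero_le_one
    have h2 := hPF F (g.comp (L : X →L[𝕜] Y))
    rw [ContinuousLinearMap.comp_apply, hgL] at h2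
    have h3 := F.le_opNorm_of_le h1
    rwa [← h2, mul_one, RCLike.norm_ofReal, abs_norm] at h3
  have hext : ∀ {x y : X}, (∀ ℓ : StrongDual 𝕜 X, ℓ x = ℓ y) → x = y := fun h =>
    (SeparatingDual.eq_iff_forall_dual_eq (R := 𝕜)).2 h
  let I₀ : StrongDual 𝕜 (StrongDual 𝕜 (LittleO 𝓛 τ)) → BigO 𝓛 := fun F =>
    (⟨P F, ⟨‖F‖, by rintro _ ⟨L, rfl⟩; exact hPL F L⟩⟩ : bigOSubmodule 𝓛)
  have hI₀ : ∀ F (ℓ : StrongDual 𝕜 X), ℓ (BigO.toX 𝓛 (I₀ F)) = F (r ℓ) := hPF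
  let I : StrongDual 𝕜 (StrongDual 𝕜 (LittleO 𝓛 τ)) →ₗ[𝕜] BigO 𝓛 :=
    { toFun := I₀
      map_add' := fun F G => BigO.toX_injective (hext fun ℓ => by simp [hI₀])
      map_smul' := fun c F => BigO.toX_injective (hext fun ℓ => by simp [hI₀]) }
  have hI : ∀ F (ℓ : StrongDual 𝕜 X), ℓ (BigO.toX 𝓛 (I F)) = F (r ℓ) := hPF
  have hle : ∀ F, ‖I F‖ ≤ ‖F‖ := fun F => BigO.norm_le (norm_nonneg F) (hPL F)
  -- `F - G` vanishes on the dense image of `X*`.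
  have hinj : Function.Injective I := fun F G hFG => sub_eq_zero.1 <| by
    ext f
    refine norm_le_zero_iff.1 (le_of_forall_pos_le_add fun ε hε => ?_)
    obtain ⟨ℓ, hℓ⟩ := LittleO.exists_norm_sub_le τ hcont f (div_pos hε (by positivity :
      0 < ‖F - G‖ + 1))
    have h0 : (F - G) (r ℓ) = 0 := by
      rw [sub_apply, ← hI, ← hI, hFG, sub_self]
    have h1 := (F - G).le_opNorm_of_le hℓ
    rw [← hr, map_sub, h0, sub_zero] at h1
    refine h1.trans ?_
    rw [zero_add, mul_div_assoc', div_le_iff₀ (by positivity)]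
    nlinarith
  have hsurj : ∀ x, ∃ F, I F = x ∧ ‖F‖ ≤ ‖x‖ := fun x => by
    obtain ⟨u, hu0, hux, hu⟩ := happrox x
    obtain ⟨F, hF, hFu⟩ := StrongDual.exists_ultrafilter_limit (hyperfilter ℕ)
      (g := fun n => NormedSpace.inclusionInDoubleDual 𝕜 (LittleO 𝓛 τ) ⟨u n, hu0 n⟩) (C := ‖x‖)
      fun n => (NormedSpace.double_dual_bound 𝕜 _ _).trans (hux n)
    refine ⟨F, BigO.toX_injective (hext fun ℓ => ?_), hF⟩
    rw [hI]
    exact tendsto_nhds_unique (hFu (r ℓ)) ((hu ℓ).mono_left Nat.hyperfilter_le_atTop)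
  have hnorm : ∀ F, ‖I F‖ = ‖F‖ := fun F => by
    obtain ⟨G, hG, hGn⟩ := hsurj (I F)
    exact (hle F).antisymm (hinj hG ▸ hGn)
  let Ii : StrongDual 𝕜 (StrongDual 𝕜 (LittleO 𝓛 τ)) →ₗᵢ[𝕜] BigO 𝓛 := ⟨I, hnorm⟩
  let e : StrongDual 𝕜 (StrongDual 𝕜 (LittleO 𝓛 τ)) ≃ₗᵢ[𝕜] BigO 𝓛 :=
    LinearIsometryEquiv.ofSurjective Ii fun x => (hsurj x).imp fun _ h => h.1
  exact ⟨e, hI, fun x => BigO.toX_injective (hext fun ℓ => hI _ ℓ)⟩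

/-- A bounded sequence in `M` that tends to zero in the norm of `X` is weak* null for every
predual of `M`. -/
theorem BigO.tendsto_predual [CompleteSpace X]
    (hcont : ∀ x : X, @Continuous 𝓛 Y τ _ fun L => (L : X →L[𝕜] Y) x)
    (happrox : ApproximationProperty 𝓛 τ) {W : Type*} [NormedAddCommGroup W] [NormedSpace 𝕜 W]
    (Ψ : BigO 𝓛 ≃ₗᵢ[𝕜] StrongDual 𝕜 W) {v : ℕ → BigO 𝓛} {C : ℝ} (hC : ∀ n, ‖v n‖ ≤ C)
    (hv : Tendsto (fun n => BigO.toX 𝓛 (v n)) atTop (𝓝 0)) (w : W) :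
    Tendsto (fun n => Ψ (v n) w) atTop (𝓝 0) := by
  refine tendsto_iff_ultrafilter _ _ _ |>.2 fun U hU => ?_
  obtain ⟨g, -, hg⟩ := StrongDual.exists_ultrafilter_limit U (g := fun n => Ψ (v n)) (C := C)
    fun n => (Ψ.norm_map _).trans_le (hC n)
  obtain ⟨y, rfl⟩ := Ψ.surjective g
  have hC0 : 0 ≤ C := (norm_nonneg _).trans (hC 0)
  -- The dual norm is weak* lower semicontinuous.
  have hlittle : ∀ z ∈ LittleO 𝓛 τ, ‖z + y‖ ≤ max ‖z‖ C := fun z hz => by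
    refine le_of_forall_pos_le_add fun ε hε => ?_
    rw [← Ψ.norm_map]
    refine ContinuousLinearMap.opNorm_le_bound _ (by positivity) fun w => ?_
    have hlim : Tendsto (fun n => ‖Ψ (z + v n) w‖) U (𝓝 ‖Ψ (z + y) w‖) := by
      simpa using ((hg w).const_add (Ψ z w)).norm
    refine le_of_tendsto hlim ?_
    filter_upwards [hU (LittleO.eventually_norm_add_le τ hcont hz hC hv hε)] with n hn
    exact ContinuousLinearMap.le_of_opNorm_le _ ((Ψ.norm_map _).trans_le hn) w
  -- The norm of `M` is lower semicontinuous for convergence in `X`.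
  have hbig : ∀ x : BigO 𝓛, ‖x + y‖ ≤ max ‖x‖ C := fun x => by
    obtain ⟨u, hu0, hux, hu⟩ := happrox.exists_tendsto x
    refine BigO.norm_le (le_max_of_le_right hC0) fun L => ?_
    have hlim : Tendsto (fun n => ‖(L : X →L[𝕜] Y) (BigO.toX 𝓛 (u n + y))‖) atTop
        (𝓝 ‖(L : X →L[𝕜] Y) (BigO.toX 𝓛 (x + y))‖) := by
      simp only [map_add (BigO.toX 𝓛)]
      exact (((L : X →L[𝕜] Y).continuous.tendsto _).comp (hu.add_const _)).norm
    exact le_of_tendsto hlim (Eventually.of_forall fun n =>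
      ((BigO.le_norm _ L).trans (hlittle _ (hu0 n))).trans (max_le_max_right C (hux n)))
  have hy : y = 0 := by
    by_contra hy
    have hy0 : 0 < ‖y‖ := norm_pos_iff.2 hy
    -- This multiple of `y` has norm `C`, so the bound reads `C + ‖y‖ ≤ C`.
    have h := hbig (((C / ‖y‖ : ℝ) : 𝕜) • y)
    have h1 : ((C / ‖y‖ : ℝ) : 𝕜) • y + y = ((C / ‖y‖ + 1 : ℝ) : 𝕜) • y := by
      push_cast; rw [add_smul, one_smul]
    rw [h1, norm_smul, norm_smul, RCLike.norm_of_nonneg (by positivity),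
      RCLike.norm_of_nonneg (by positivity), add_mul, div_mul_cancel₀ _ hy0.ne', max_self] at h
    linarith
  simpa [hy] using hg w

end LittleODuality

/-- If an isometric isomorphism `V* ≃ W*` is the adjoint of a linear map `W → V`, then that map is
an isometric isomorphism. -/
theorem exists_isometryEquiv_of_apply_eq {𝕜 V W : Type*} [RCLike 𝕜]
    [NormedAddCommGroup V] [NormedSpace 𝕜 V] [NormedAddCommGroup W] [NormedSpace 𝕜 W]
    [CompleteSpace W] (Φ : StrongDual 𝕜 V ≃ₗᵢ[𝕜] StrongDual 𝕜 W) (φ : W →ₗ[𝕜] V)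
    (hφ : ∀ F w, Φ F w = F (φ w)) :
    ∃ φ : W ≃ₗᵢ[𝕜] V, ∀ (F : StrongDual 𝕜 V) (w : W), Φ F w = F (φ w) := by
  have hnorm : ∀ w, ‖φ w‖ = ‖w‖ := fun w => by
    refine le_antisymm ?_ ?_
    · obtain ⟨F, hF, hFw⟩ := exists_dual_vector'' 𝕜 (φ w)
      have h := (Φ F).le_of_opNorm_le ((Φ.norm_map F).trans_le hF) w
      rwa [hφ, hFw, RCLike.norm_ofReal, abs_norm, one_mul] at h
    · obtain ⟨g, hg, hgw⟩ := exists_dual_vector'' 𝕜 w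
      have h := (Φ.symm g).le_of_opNorm_le ((Φ.symm.norm_map g).trans_le hg) (φ w)
      rwa [← hφ, Φ.apply_symm_apply, hgw, RCLike.norm_ofReal, abs_norm, one_mul] at h
  let φi : W →ₗᵢ[𝕜] V := ⟨φ, hnorm⟩
  have hclosed : IsClosed (LinearMap.range φ : Set V) := by
    rw [LinearMap.coe_range]
    exact φi.isometry.isClosedEmbedding.isClosed_range
  -- A functional vanishing on the closed range is killed by the injective `Φ`.
  have hsurj : Function.Surjective φi := fun v => by
    by_contra hv
    obtain ⟨F, hF, hFv⟩ := exists_strongDual_vanishing (LinearMap.range φ) hclosed (x := v) hv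
    have h0 : Φ F = 0 := by
      ext w
      rw [hφ, hF _ ⟨w, rfl⟩]
      rfl
    rw [map_eq_zero_iff Φ Φ.injective] at h0
    simp [h0] at hFv
  exact ⟨LinearIsometryEquiv.ofSurjective φi hsurj, hφ⟩

/-! ### Uniqueness of the predual of `M₀**`, non-uniqueness for `M₀*`. -/

section LittleOPreduals

variable {𝕜 : Type k} {X : Type u} {Y : Type v} [RCLike 𝕜] [NormedAddCommGroup X]
  [NormedSpace 𝕜 X]
  [NormedAddCommGroup Y] [NormedSpace 𝕜 Y] {𝓛 : Set (X →L[𝕜] Y)} [ContinuouslyContained 𝓛]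
  {τ : TopologicalSpace 𝓛}

theorem LittleO.isStronglyUniquePredual_dual [CompleteSpace X]
    (hcont : ∀ x : X, @Continuous 𝓛 Y τ _ fun L => (L : X →L[𝕜] Y) x)
    (happrox : ApproximationProperty 𝓛 τ)
    (I : StrongDual 𝕜 (StrongDual 𝕜 (LittleO 𝓛 τ)) ≃ₗᵢ[𝕜] BigO 𝓛)
    (hI : ∀ x : LittleO 𝓛 τ, I (NormedSpace.inclusionInDoubleDual 𝕜 (LittleO 𝓛 τ) x) = x) :
    IsStronglyUniquePredual.{max u k, w, k} 𝕜 (StrongDual 𝕜 (LittleO 𝓛 τ)) := by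
  intro W _ _ _ Φ
  let ι := NormedSpace.inclusionInDoubleDual 𝕜 (LittleO 𝓛 τ)
  -- The only candidate: its adjoint agrees with `Φ` on `M₀`. Weak* convergence for both preduals
  -- carries the identity to all of `M₀**`.
  let φ : W →L[𝕜] StrongDual 𝕜 (LittleO 𝓛 τ) :=
    ((Φ.toContinuousLinearEquiv : _ →L[𝕜] StrongDual 𝕜 W).comp ι).flip
  have hφ : ∀ w z, φ w z = Φ (ι z) w := fun w z => rfl
  refine exists_isometryEquiv_of_apply_eq Φ φ.toLinearMap fun F w => ?_
  obtain ⟨u, hu0, hux, hu⟩ := happrox.exists_tendsto (I F)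
  have hC : ∀ n, ‖I F - u n‖ ≤ ‖I F‖ + ‖I F‖ := fun n =>
    (norm_sub_le _ _).trans (add_le_add_right (hux n) _)
  have hv : Tendsto (fun n => BigO.toX 𝓛 (I F - u n)) atTop (𝓝 0) := by
    simpa using hu.const_sub (BigO.toX 𝓛 (I F))
  have hsymm : ∀ n, I.symm (u n) = ι ⟨u n, hu0 n⟩ := fun n =>
    I.symm_apply_eq.2 (hI ⟨u n, hu0 n⟩).symm
  have h1 := BigO.tendsto_predual hcont happrox (I.symm.trans Φ) hC hv w
  have h2 := BigO.tendsto_predual hcont happrox I.symm hC hv (φ w)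
  have h3 : Tendsto (fun _ : ℕ => Φ F w - F (φ w)) atTop (𝓝 0) := by
    refine (sub_zero (0 : 𝕜) ▸ h1.sub h2).congr fun n => ?_
    simp only [LinearIsometryEquiv.trans_apply, map_sub, LinearIsometryEquiv.symm_apply_apply,
      sub_apply, hsymm]
    simp [ι, hφ]
  exact sub_eq_zero.1 (tendsto_nhds_unique tendsto_const_nhds h3)

theorem LittleO.symm_apply
    (I : StrongDual 𝕜 (StrongDual 𝕜 (LittleO 𝓛 τ)) ≃ₗᵢ[𝕜] BigO 𝓛)
    (hI : ∀ x : LittleO 𝓛 τ, I (NormedSpace.inclusionInDoubleDual 𝕜 (LittleO 𝓛 τ) x) = x)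
    (z : LittleO 𝓛 τ) (f : StrongDual 𝕜 (LittleO 𝓛 τ)) : I.symm (z : BigO 𝓛) f = f z := by
  rw [I.symm_apply_eq.2 (hI z).symm]
  rfl

theorem half_le_norm_one_add {c : 𝕜} (hc : ‖c‖ ≤ 1 / 4) : 1 / 2 ≤ ‖1 + c‖ := by
  have := norm_sub_norm_le (1 : 𝕜) (-c)
  rw [norm_one, norm_neg, sub_neg_eq_add] at this
  linarith

theorem exists_ne_zero_norm_mul_le {E : Type*} [NormedAddCommGroup E] [NormedSpace 𝕜 E] {f : E}
    (hf : f ≠ 0) {r : ℝ} (hr : 0 < r) : ∃ g : E, g ≠ 0 ∧ ‖g‖ * r ≤ 1 / 4 := by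
  have hf' : 0 < ‖f‖ := norm_pos_iff.2 hf
  have hc : 0 < 1 / (4 * ‖f‖ * r) := by positivity
  refine ⟨((1 / (4 * ‖f‖ * r) : ℝ) : 𝕜) • f, smul_ne_zero (RCLike.ofReal_ne_zero.2 hc.ne') hf, ?_⟩
  rw [norm_smul, RCLike.norm_of_nonneg hc.le]
  apply le_of_eq
  field_simp

theorem LittleO.norm_apply_le
    (I : StrongDual 𝕜 (StrongDual 𝕜 (LittleO 𝓛 τ)) ≃ₗᵢ[𝕜] BigO 𝓛) {G : BigO 𝓛}
    {f : StrongDual 𝕜 (LittleO 𝓛 τ)} (hfG : ‖f‖ * ‖G‖ ≤ 1 / 4) {y : BigO 𝓛} (hy : ‖y‖ ≤ ‖G‖) :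
    ‖I.symm y f‖ ≤ 1 / 4 := by
  refine ((I.symm y).le_of_opNorm_le ((I.symm.norm_map y).trans_le hy) f).trans ?_
  rwa [mul_comm]

/-- For `f` small, the subspace `{z + f(z) G : z ∈ M₀}` of `M = M₀**` is norming for `M₀*`. -/
theorem LittleO.norm_le_of_perturbation [CompleteSpace X]
    (hcont : ∀ x : X, @Continuous 𝓛 Y τ _ fun L => (L : X →L[𝕜] Y) x)
    (happrox : ApproximationProperty 𝓛 τ)
    (I : StrongDual 𝕜 (StrongDual 𝕜 (LittleO 𝓛 τ)) ≃ₗᵢ[𝕜] BigO 𝓛)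
    (hI : ∀ x : LittleO 𝓛 τ, I (NormedSpace.inclusionInDoubleDual 𝕜 (LittleO 𝓛 τ) x) = x)
    {G : BigO 𝓛} {f : StrongDual 𝕜 (LittleO 𝓛 τ)} (hfG : ‖f‖ * ‖G‖ ≤ 1 / 4)
    (g : StrongDual 𝕜 (LittleO 𝓛 τ)) {c : ℝ} (hc : 0 ≤ c)
    (hg : ∀ z : LittleO 𝓛 τ, ‖I.symm ((z : BigO 𝓛) + f z • G) g‖ ≤ c * ‖(z : BigO 𝓛) + f z • G‖) :
    ‖g‖ ≤ c := by
  refine ContinuousLinearMap.opNorm_le_bound _ hc fun z => ?_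
  obtain ⟨u, hu0, hux, hu⟩ := happrox.exists_tendsto G
  -- Chosen so that `f (z - t n • u n) = t n`, which puts `z + t n • (G - u n)` in the tilted
  -- subspace while it tends weak* to `z`.
  let t : ℕ → 𝕜 := fun n => f z / (1 + f ⟨u n, hu0 n⟩)
  have hu' : ∀ n, 1 / 2 ≤ ‖1 + f ⟨u n, hu0 n⟩‖ := fun n => half_le_norm_one_add (by
    rw [← LittleO.symm_apply I hI]
    exact LittleO.norm_apply_le I hfG (hux n))
  have ht : ∀ n, ‖t n‖ ≤ 2 * (‖f‖ * ‖z‖) := fun n => by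
    rw [norm_div, div_le_iff₀ (by linarith [hu' n])]
    nlinarith [f.le_opNorm z, hu' n, norm_nonneg (f z), mul_nonneg (norm_nonneg f)
      (norm_nonneg z)]
  have hv : Tendsto (fun n => BigO.toX 𝓛 (t n • (G - u n))) atTop (𝓝 0) := by
    simp only [map_smul]
    refine squeeze_zero_norm (a := fun n => 2 * (‖f‖ * ‖z‖) * ‖BigO.toX 𝓛 (G - u n)‖)
      (fun n => ?_) ?_
    · rw [norm_smul]
      exact mul_le_mul_of_nonneg_right (ht n) (norm_nonneg _)
    · simpa using ((hu.const_sub (BigO.toX 𝓛 G)).norm).const_mul (2 * (‖f‖ * ‖z‖))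
  -- The constant 1/4 is used up here: `2‖f‖‖z‖ · 2‖G‖ ≤ ‖z‖`. The correction then does not raise
  -- the norm above `‖z‖ + ε`.
  have hC : ∀ n, ‖t n • (G - u n)‖ ≤ ‖z‖ := fun n => by
    have h1 : ‖G - u n‖ ≤ 2 * ‖G‖ := by linarith [norm_sub_le G (u n), hux n]
    rw [norm_smul]
    refine (mul_le_mul (ht n) h1 (norm_nonneg _) (by positivity)).trans ?_
    nlinarith [mul_le_mul_of_nonneg_right hfG (norm_nonneg z)]
  have hp : ∀ n, (z : BigO 𝓛) + t n • (G - u n) = ((z - t n • ⟨u n, hu0 n⟩ : LittleO 𝓛 τ) : BigO 𝓛) +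
      f (z - t n • ⟨u n, hu0 n⟩) • G := fun n => by
    have hne : 1 + f ⟨u n, hu0 n⟩ ≠ 0 := norm_pos_iff.1 (by linarith [hu' n])
    have : f z - t n * f ⟨u n, hu0 n⟩ = t n := by
      simp only [t]
      field_simp
      ring
    rw [map_sub, map_smul, smul_eq_mul, this]
    simp only [Submodule.coe_sub, Submodule.coe_smul, smul_sub]
    abel
  have hlim : Tendsto (fun n => ‖I.symm ((z : BigO 𝓛) + t n • (G - u n)) g‖) atTop
      (𝓝 ‖g z‖) := by
    have := ((BigO.tendsto_predual hcont happrox I.symm hC hv g).const_add (g z)).norm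
    rw [add_zero] at this
    refine this.congr fun n => ?_
    rw [map_add, add_apply, LittleO.symm_apply I hI]
  refine le_of_forall_pos_le_add fun δ hδ => le_of_tendsto hlim ?_
  have hε : 0 < δ / (c + 1) := by positivity
  filter_upwards [LittleO.eventually_norm_add_le τ hcont z.2 hC hv hε] with n hn
  rw [hp] at hn ⊢
  refine (hg _).trans ((mul_le_mul_of_nonneg_left hn hc).trans ?_)
  have : c * (δ / (c + 1)) ≤ δ := by
    rw [mul_div_assoc', div_le_iff₀ (by positivity)]
    nlinarith
  rw [max_eq_right (show ‖(z : BigO 𝓛)‖ ≤ ‖z‖ from le_rfl), mul_add]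
  linarith

theorem LittleO.not_isStronglyUniquePredual [CompleteSpace X] [CompleteSpace (BigO 𝓛)]
    (hcont : ∀ x : X, @Continuous 𝓛 Y τ _ fun L => (L : X →L[𝕜] Y) x)
    (happrox : ApproximationProperty 𝓛 τ) (hne : LittleO 𝓛 τ ≠ ⊤)
    (I : StrongDual 𝕜 (StrongDual 𝕜 (LittleO 𝓛 τ)) ≃ₗᵢ[𝕜] BigO 𝓛)
    (hI : ∀ x : LittleO 𝓛 τ, I (NormedSpace.inclusionInDoubleDual 𝕜 (LittleO 𝓛 τ) x) = x) :
    ¬ IsStronglyUniquePredual.{u, u, k} 𝕜 (LittleO 𝓛 τ) := by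
  intro H
  have hsymm := LittleO.symm_apply I hI
  obtain ⟨G, hG⟩ : ∃ G, G ∉ LittleO 𝓛 τ := by
    by_contra! h
    exact hne (eq_top_iff.2 fun x _ => h x)
  have hG0 : 0 < ‖G‖ := norm_pos_iff.2 fun h => hG (h ▸ zero_mem _)
  obtain ⟨f, hf⟩ : ∃ f : StrongDual 𝕜 (LittleO 𝓛 τ), f ≠ 0 := by
    by_contra! h
    have h1 : ‖I.symm G‖ ≤ 0 :=
      ContinuousLinearMap.opNorm_le_bound _ le_rfl fun f => by simp [h f]
    rw [I.symm.norm_map] at h1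
    exact hG0.not_ge h1
  obtain ⟨f, hf0, hfG⟩ := exists_ne_zero_norm_mul_le (𝕜 := 𝕜) hf hG0
  let S : LittleO 𝓛 τ →L[𝕜] BigO 𝓛 := (LittleO 𝓛 τ).subtypeL + f.smulRight G
  have hS : ∀ z, S z = (z : BigO 𝓛) + f z • G := fun z => rfl
  have hSbound : ∀ z, ‖z‖ ≤ (4 / 3 : NNReal) * ‖S z‖ := fun z => by
    have h1 := norm_sub_norm_le (z : BigO 𝓛) (-(f z • G))
    rw [norm_neg, sub_neg_eq_add, ← hS, norm_smul] at h1
    change ‖z‖ - _ ≤ _ at h1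
    have h2 : ‖f z‖ * ‖G‖ ≤ ‖z‖ / 4 := by
      nlinarith [mul_le_mul_of_nonneg_right (f.le_opNorm z) hG0.le,
        mul_le_mul_of_nonneg_right hfG (norm_nonneg z)]
    push_cast
    linarith
  have hSclosed : IsClosed (LinearMap.range S.toLinearMap : Set (BigO 𝓛)) := by
    rw [LinearMap.coe_range]
    exact (S.antilipschitz_of_bound hSbound).isClosed_range S.uniformContinuous
  let W := LinearMap.range S.toLinearMap
  have : CompleteSpace W := hSclosed.completeSpace_coe
  let T : StrongDual 𝕜 (LittleO 𝓛 τ) →L[𝕜] StrongDual 𝕜 W :=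
    ((I.symm.toContinuousLinearEquiv : BigO 𝓛 →L[𝕜] _).comp W.subtypeL).flip
  have hT : ∀ g (p : W), T g p = I.symm p g := fun g p => rfl
  have hTle : ∀ g, ‖T g‖ ≤ ‖g‖ := fun g =>
    ContinuousLinearMap.opNorm_le_bound _ (norm_nonneg _) fun p => by
      rw [hT, mul_comm]
      exact (I.symm (p : BigO 𝓛)).le_of_opNorm_le (I.symm.norm_map _).le g
  have hTge : ∀ g, ‖g‖ ≤ ‖T g‖ := fun g =>
    LittleO.norm_le_of_perturbation hcont happrox I hI hfG g (norm_nonneg _) fun z =>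
      (T g).le_opNorm ⟨S z, z, rfl⟩
  have hTsurj : Function.Surjective T := fun h => by
    let g : StrongDual 𝕜 (LittleO 𝓛 τ) := h.comp (S.codRestrict W fun z => ⟨z, rfl⟩)
    have hne : 1 + I.symm G f ≠ 0 := norm_pos_iff.1
      (by linarith [half_le_norm_one_add (LittleO.norm_apply_le I hfG le_rfl)])
    -- A preimage `g'` must satisfy `g' + G(g') f = g`; applying `G` yields `G(g') = G(g) / (1 +
    -- G(f))`.
    refine ⟨g - (I.symm G g / (1 + I.symm G f)) • f, ?_⟩
    ext ⟨_, z, rfl⟩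
    have hg : g z = h ⟨S z, z, rfl⟩ := rfl
    rw [hT]
    change I.symm (S z) _ = h ⟨S z, z, rfl⟩
    rw [← hg, hS, map_add, map_smul, add_apply, hsymm,
      smul_apply, map_sub, map_smul]
    simp only [sub_apply, smul_apply, smul_eq_mul]
    field_simp
    ring
  obtain ⟨φ, hφ⟩ := H W (LinearIsometryEquiv.ofSurjective
    ⟨T.toLinearMap, fun g => (hTle g).antisymm (hTge g)⟩ hTsurj)
  -- An adjoint would force `p` and `φ p` to agree as functionals on `M₀*`, so `W ⊆ M₀` and `G ∈
  -- M₀`.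
  have hW : ∀ p : W, (p : BigO 𝓛) = φ p := fun p => I.symm.injective (by
    ext g
    rw [hsymm, ← hφ]
    rfl)
  obtain ⟨z, hz⟩ : ∃ z, f z ≠ 0 := by
    by_contra! h
    exact hf0 (ContinuousLinearMap.ext h)
  have hmem : (z : BigO 𝓛) + f z • G ∈ LittleO 𝓛 τ := by
    have := hW ⟨S z, z, rfl⟩
    rw [← hS, show S z = _ from this]
    exact (φ _).2
  refine hG (((LittleO 𝓛 τ).smul_mem_iff hz).1 ?_)
  simpa using sub_mem hmem z.2

end LittleOPreduals

theorem corollary1p3 {𝕜 : Type k} [RCLike 𝕜]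
    {X : Type u} [NormedAddCommGroup X] [NormedSpace 𝕜 X] [CompleteSpace X]
    [TopologicalSpace.SeparableSpace X]
    -- `X` is reflexive
    (hX : Function.Surjective (NormedSpace.inclusionInDoubleDual 𝕜 X))
    {Y : Type v} [NormedAddCommGroup Y] [NormedSpace 𝕜 Y] [CompleteSpace Y]
    (𝓛 : Set (X →L[𝕜] Y)) (τ : TopologicalSpace 𝓛)
    (hT2 : @T2Space 𝓛 τ) (hσ : @SigmaCompactSpace 𝓛 τ) (hlc : @LocallyCompactSpace 𝓛 τ)
    (hcont : ∀ x : X, @Continuous 𝓛 Y τ _ fun L => (L : X →L[𝕜] Y) x)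
    (hdense : Dense (bigOSubmodule 𝓛 : Set X))
    [ContinuouslyContained 𝓛] [CompleteSpace (BigO 𝓛)]
    (happrox : ApproximationProperty 𝓛 τ)
    (hne : LittleO 𝓛 τ ≠ ⊤) :
    -- `M₀*` is a predual of `M`, by way of the adjoint `M₀** → X** = X` of `X* → M₀*`,
    -- which extends the identity of `M₀`
    (∃ I : StrongDual 𝕜 (StrongDual 𝕜 (LittleO 𝓛 τ)) ≃ₗᵢ[𝕜] BigO 𝓛,
      (∀ (F : StrongDual 𝕜 (StrongDual 𝕜 (LittleO 𝓛 τ))) (ℓ : StrongDual 𝕜 X),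
        ℓ (BigO.toX 𝓛 (I F)) = F ((ℓ.comp (BigO.toX 𝓛)).comp (LittleO 𝓛 τ).subtypeL)) ∧
      (∀ x : LittleO 𝓛 τ, I (NormedSpace.inclusionInDoubleDual 𝕜 (LittleO 𝓛 τ) x) = x)) ∧
    -- and it is the strongly unique one (the space `W` may lie in any universe `w`)
    IsStronglyUniquePredual.{max u k, w, k} 𝕜 (StrongDual 𝕜 (LittleO 𝓛 τ)) ∧
    -- but `M₀` is not a strongly unique predual of its dual
    ¬ IsStronglyUniquePredual.{u, u, k} 𝕜 (LittleO 𝓛 τ) := by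
  obtain ⟨I, hI, hI'⟩ := LittleO.exists_bidual_equiv hX hcont happrox
  exact ⟨⟨I, hI, hI'⟩, LittleO.isStronglyUniquePredual_dual hcont happrox I hI',
    LittleO.not_isStronglyUniquePredual hcont happrox hne I hI'⟩
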